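/- Let $n>2k\ge 6$ be integers, and write $[i]=\{1,\dots,i\}$ and $[2,i]=\{2,\dots,i\}$. For finite sets $A,B$ of positive integers put $A\le B$ if $A\supseteq B$ or $\min(A\setminus B)<\min(B\setminus A)$, and put $A<B$ if $A\le B$ and $A\ne B$. For a set $S$ and an integer $a$ let $$\mathcal L(S,a)=\Big\{A\in\tbinom{[2,n]}{a} : A\le S\cap[2,n]\Big\}.$$ Sets $S\subset[n]$ and $T\subset[2,n]$ *strongly intersect in their largest element* if there is $j$ with $S\cap T=\{j\}$ and $S\cup T=[j]$. Sets $S\subset [n]$, $T\subset[2,n]$ form a *resistant pair* if either $T=\{2,3,4\}$ and $S=\{1,4\}$, or, with $j$ the largest element of $T$, one has $S\cap T=\{j\}$, $S\cup T=[j]$, $|S|\le k$, $|T|\le k$, and $|[i]\cap S|<|[i]\setminus S|$ for every $i\ge 4$. Let $(S_1,T_1),\dots,(S_m,T_m)$ be all the resistant pairs, put $T_0=[2,n]$ and $S_0=\{1,n\}$, and let the numbering be such that $T_0<T_1<\dots<T_m$. A set is called *$T_l$-neutral* if it is obtained from $T_l$ by finitely many (possibly zero) steps, each replacing a set $T'$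 by $T'\cup\{2|T'|\}$; a pair $S,T$ strongly intersecting in its largest element is *$T_l$-neutral* if $T$ is $T_l$-neutral. **Theorem.** Let $S\subset[n]$ and $T\subset[2,n]$, with $|S|\le k$ and $|T|\le k$, strongly intersect in their largest element, and let $\mathcal A=\mathcal L(S,k-1)$ and $\mathcal B=\mathcal L(T,k)$. If $T_{l-1}<T\le T_l$ for some $l\in[m]$, then the equality $$|\mathcal A|+|\mathcal B|=|\mathcal L(S_l,k-1)|+|\mathcal L(T_l,k)|$$ holds if and only if the pair $S,T$ is $T_l$-neutral. -/

import Mathlib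

/-!
Complementation in `[2, n]` exchanges the sets preceding `S` with the sets not preceding `T`, so
`|𝓛(S, k - 1)| + |𝓛(T, k)|` equals `(n - 1).choose (k - 1)` minus the gap
`|𝓛(T, n - k)| - |𝓛(T, k)|`, and only the dependence of the gap on `T` matters.

The sets after `X ∪ {i}` and up to `X`, where `max X < i`, are exactly those with trace `X` on
`[i]`. For `i = 2|X|` there are `n - 2|X|` elements left above `i`, and prescribing `k - |X|` or
`n - k - |X|` of them can be done in equally many ways. Hence a neutral step does not change the
gap. If instead `T` has trace `X` on `[i]` but goes on beyond `i`, then the sets `B` above `i` with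
`X ∪ B ≤ T` form a proper up-set, which contains strictly more sets of the larger size
`n - k - |X|` than of size `k - |X|`, and the gap of `T` exceeds that of `X ∪ {i}`.

Finally, `T` either satisfies a ballot condition and is neutral to a resistant set, which must be
`T_l`, or it has a shortest initial segment `X` at which the ballot condition is about to fail.
Then `X` and `X ∪ {2|X|}` are `T_l`-neutral, so the gap of `T` is larger than that of `T_l`.
-/

/-- The lexicographical/containment order on sets of positive integers: `A ≺ B` iff `A ⊇ B`, or the
minimal element of `A \ B` is smaller than the minimal element of `B \ A`. -/
def lexLE (A B : Finset ℕ) : Prop :=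
  B ⊆ A ∨ ∃ x ∈ A \ B, ∀ y ∈ B \ A, x < y

instance : DecidableRel lexLE := fun A B => by
  unfold lexLE
  infer_instance

/-- The strict version of the order. -/
def lexLT (A B : Finset ℕ) : Prop :=
  lexLE A B ∧ A ≠ B

/-- The lexicographic family `𝓛([2, n], S, a)` of all `a`-element subsets of `[2, n]` that precede
`S ∩ [2, n]` (this is used for `|S ∩ [2, n]| ≤ a`, and for `S = [2, n]`, which gives the empty
family). -/
def lexFamily (n : ℕ) (S : Finset ℕ) (a : ℕ) : Finset (Finset ℕ) :=
  (Finset.powersetCard a (Finset.Icc 2 n)).filter (fun A => lexLE A (S ∩ Finset.Icc 2 n))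

/-- `S ⊆ [n]` (with `1 ∈ S`) and `T ⊆ [2, n]` strongly intersect in their largest element `j`:
`S ∩ T = {j}` and `S ∪ T = [j]`. -/
def StronglyIntersectInLargest (S T : Finset ℕ) : Prop :=
  ∃ j : ℕ, S ∩ T = {j} ∧ S ∪ T = Finset.Icc 1 j

/-- `S ⊆ [n]` and `T ⊆ [2, n]` form a resistant pair (with respect to `k`). -/
def IsResistantPair (n k : ℕ) (S T : Finset ℕ) : Prop :=
  S ⊆ Finset.Icc 1 n ∧ T ⊆ Finset.Icc 2 n ∧
    ((T = {2, 3, 4} ∧ S = {1, 4}) ∨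
      ∃ j : ℕ, IsGreatest (T : Set ℕ) j ∧
        (S ∩ T = {j} ∧ S ∪ T = Finset.Icc 1 j ∧ S.card ≤ k ∧ T.card ≤ k) ∧
        ∀ i : ℕ, 4 ≤ i → (Finset.Icc 1 i ∩ S).card < (Finset.Icc 1 i \ S).card)

/-- `(S 1, T 1), …, (S m, T m)` are all the resistant pairs, `T 0 = [2, n]`, `S 0 = {1, n}`, and
`T 0 < T 1 < ⋯ < T m`. (The values of `S` and `T` at indices above `m` play no role.) -/
structure IsResistantEnumeration (n k m : ℕ) (S T : ℕ → Finset ℕ) : Prop where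
  T_zero : T 0 = Finset.Icc 2 n
  S_zero : S 0 = {1, n}
  mem_iff : ∀ P Q : Finset ℕ,
    IsResistantPair n k P Q ↔ ∃ l ∈ Finset.Icc 1 m, S l = P ∧ T l = Q
  strictMono : ∀ i j : ℕ, i < j → j ≤ m → lexLT (T i) (T j)

/-- The sets `T` obtained from `R` by repeatedly passing from `T'` to `T' ∪ {2|T'|}`. -/
inductive IsNeutralSet (R : Finset ℕ) : Finset ℕ → Prop
  | base : IsNeutralSet R R
  | step (T' : Finset ℕ) : IsNeutralSet R T' → IsNeutralSet R (T' ∪ {2 * T'.card})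

/-- The pair `(S, T)` of sets, strongly intersecting in their largest element, is `R`-neutral. -/
def IsNeutralPair (R S T : Finset ℕ) : Prop :=
  StronglyIntersectInLargest S T ∧ IsNeutralSet R T


section

open Finset

/-! ### The lexicographic order -/

/-- `A` as an element of the colexicographic order over the reversed natural numbers. This order is
opposite to `lexLE`, which makes `lexLE` a linear order. -/
def lexKey (A : Finset ℕ) : Colex (Finset ℕᵒᵈ) :=
  toColex (A.map OrderDual.toDual.toEmbedding)

theorem lexKey_injective : Function.Injective lexKey := fun _ _ h =>
  map_injective _ (toColex.injective h)

theorem lexKey_le_lexKey_iff {A B : Finset ℕ} :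
    lexKey B ≤ lexKey A ↔ ∀ y ∈ B, y ∉ A → ∃ x ∈ A, x ∉ B ∧ x ≤ y := by
  simp [lexKey, Colex.toColex_le_toColex]

theorem lexLE_iff_lexKey_le {A B : Finset ℕ} : lexLE A B ↔ lexKey B ≤ lexKey A := by
  rw [lexKey_le_lexKey_iff]
  constructor
  · rintro (hBA | ⟨x, hx, hxy⟩) y hyB hyA
    · exact absurd (hBA hyB) hyA
    · rw [mem_sdiff] at hx
      exact ⟨x, hx.1, hx.2, (hxy y (mem_sdiff.2 ⟨hyB, hyA⟩)).le⟩
  · intro h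
    by_cases hBA : B ⊆ A
    · exact Or.inl hBA
    have hne : (B \ A).Nonempty := sdiff_nonempty.2 hBA
    have hmin := mem_sdiff.1 (min'_mem _ hne)
    obtain ⟨x, hxA, hxB, hx⟩ := h _ hmin.1 hmin.2
    have hx_lt : x < (B \ A).min' hne := hx.lt_of_ne fun hxe => hxB (hxe ▸ hmin.1)
    exact Or.inr ⟨x, mem_sdiff.2 ⟨hxA, hxB⟩, fun y hy => hx_lt.trans_le (min'_le _ y hy)⟩

theorem lexLT_iff_lexKey_lt {A B : Finset ℕ} : lexLT A B ↔ lexKey B < lexKey A := by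
  rw [lexLT, lexLE_iff_lexKey_le, lt_iff_le_and_ne, ne_comm, lexKey_injective.ne_iff]

theorem lexLT_iff {A B : Finset ℕ} :
    lexLT A B ↔ ∃ x ∈ A, x ∉ B ∧ ∀ y ∈ B, y ∉ A → x < y := by
  rw [lexLT_iff_lexKey_lt]
  simp [lexKey, Colex.toColex_lt_toColex_iff_exists_forall_lt]

theorem not_lexLE {A B : Finset ℕ} : ¬ lexLE A B ↔ lexLT B A := by
  rw [lexLE_iff_lexKey_le, lexLT_iff_lexKey_lt, not_le]

theorem lexLE_trans {A B C : Finset ℕ} (hAB : lexLE A B) (hBC : lexLE B C) : lexLE A C := by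
  rw [lexLE_iff_lexKey_le] at *
  exact hBC.trans hAB

theorem lexLE_antisymm {A B : Finset ℕ} (hAB : lexLE A B) (hBA : lexLE B A) : A = B := by
  rw [lexLE_iff_lexKey_le] at hAB hBA
  exact lexKey_injective (hBA.antisymm hAB)

theorem lexLT_of_lexLT_of_lexLE {A B C : Finset ℕ} (hAB : lexLT A B) (hBC : lexLE B C) :
    lexLT A C := by
  rw [lexLT_iff_lexKey_lt] at *
  exact (lexLE_iff_lexKey_le.1 hBC).trans_lt hAB

theorem subset_of_lexLE_of_lexLT_insert {A X : Finset ℕ} {i : ℕ} (hX : ∀ x ∈ X, x < i)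
    (hAX : lexLE A X) (h : lexLT (insert i X) A) : X ⊆ A := by
  by_contra hXA
  obtain ⟨x, hx, hxy⟩ := hAX.resolve_left hXA
  obtain ⟨y, hyX, hyA⟩ := not_subset.1 hXA
  obtain ⟨w, hwX, hwA, hw⟩ := lexLT_iff.1 h
  rw [mem_sdiff] at hx
  have hxi : x < i := (hxy y (mem_sdiff.2 ⟨hyX, hyA⟩)).trans (hX y hyX)
  have hwx : w < x := hw x hx.1 (by simp [hxi.ne, hx.2])
  rcases mem_insert.1 hwX with rfl | hwX
  · exact hwx.not_gt hxi
  · exact hwx.not_gt (hxy w (mem_sdiff.2 ⟨hwX, hwA⟩))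

theorem inter_Iic_eq_iff {A X : Finset ℕ} {i : ℕ} (hX : ∀ x ∈ X, x < i) :
    A ∩ Iic i = X ↔ lexLE A X ∧ lexLT (insert i X) A := by
  constructor
  · intro h
    have hiX : i ∉ X := fun hi => (hX i hi).false
    refine ⟨Or.inl (h ▸ inter_subset_left), lexLT_iff.2 ⟨i, mem_insert_self _ _, ?_, ?_⟩⟩
    · exact fun hi => hiX (h ▸ mem_inter.2 ⟨hi, mem_Iic.2 le_rfl⟩)
    · intro y hyA hy
      by_contra! hyi
      exact hy (mem_insert_of_mem (h ▸ mem_inter.2 ⟨hyA, mem_Iic.2 hyi⟩))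
  · rintro ⟨hAX, h⟩
    have hXA : X ⊆ A := subset_of_lexLE_of_lexLT_insert hX hAX h
    obtain ⟨w, hwX, hwA, hw⟩ := lexLT_iff.1 h
    obtain rfl : w = i := (mem_insert.1 hwX).resolve_right fun hwX => hwA (hXA hwX)
    ext y
    refine ⟨fun hy => ?_, fun hy => mem_inter.2 ⟨hXA hy, mem_Iic.2 (hX y hy).le⟩⟩
    obtain ⟨hyA, hyw⟩ := mem_inter.1 hy
    by_contra hyX
    have hy_ne : y ≠ w := fun h => hwA (h ▸ hyA)
    have hwy : w < y := hw y hyA (by simp [hy_ne, hyX])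
    exact (mem_Iic.1 hyw).not_gt hwy

theorem Icc_subset_of_lexLE {c d : ℕ} {A B : Finset ℕ} (hA : ∀ x ∈ A, c ≤ x) (hB : Icc c d ⊆ B)
    (h : lexLE A B) : Icc c d ⊆ A := by
  rcases h with h | ⟨x, hx, hxy⟩
  · exact hB.trans h
  rw [mem_sdiff] at hx
  intro y hy
  by_contra hyA
  have hxy := hxy y (mem_sdiff.2 ⟨hB hy, hyA⟩)
  exact hx.2 (hB (mem_Icc.2 ⟨hA x hx.1, hxy.le.trans (mem_Icc.1 hy).2⟩))

/-! ### Counting subsets of fixed size -/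

theorem card_filter_powersetCard_inter_eq {α : Type*} [DecidableEq α] {s t X : Finset α} {a : ℕ}
    (hXs : X ⊆ s) (hXt : X ⊆ t) (ha : #X ≤ a) (p : Finset α → Prop) [DecidablePred p] :
    #{A ∈ powersetCard a s | A ∩ t = X ∧ p A} =
      #{B ∈ powersetCard (a - #X) (s \ t) | p (X ∪ B)} := by
  symm
  refine card_nbij' (X ∪ ·) (· \ t) ?_ ?_ ?_ ?_
  · intro B hB
    simp only [coe_filter, mem_powersetCard, Set.mem_ofPred_eq] at hB ⊢
    have hXB : Disjoint X B := by grind [disjoint_left]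
    refine ⟨⟨by grind, ?_⟩, by grind, hB.2⟩
    rw [card_union_of_disjoint hXB, hB.1.2]
    omega
  · intro A hA
    simp only [coe_filter, mem_powersetCard, Set.mem_ofPred_eq] at hA ⊢
    obtain ⟨⟨hAs, rfl⟩, rfl, hpA⟩ := hA
    refine ⟨⟨sdiff_subset_sdiff hAs subset_rfl, ?_⟩, ?_⟩
    · have := card_inter_add_card_sdiff A t
      omega
    · rwa [union_comm, sdiff_union_inter]
  · intro B hB
    grind
  · intro A hA
    grind

theorem card_filter_powersetCard_lt_of_monotone {α : Type*} {s : Finset α} {a b : ℕ}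
    (hab : a + b ≤ #s) {p : Finset α → Prop} [DecidablePred p] (hp : Monotone p)
    {A₀ B₀ : Finset α} (hAB : A₀ ⊆ B₀) (hBs : B₀ ⊆ s) (hA : #A₀ = a) (hB : #B₀ = b)
    (hpA : ¬ p A₀) (hpB : p B₀) :
    #{A ∈ powersetCard a s | p A} < #{B ∈ powersetCard b s | p B} := by
  classical
  have hle : a ≤ b := hA ▸ hB ▸ card_le_card hAB
  have hup : ∀ A ∈ {A ∈ powersetCard a s | p A},
      #(bipartiteAbove (· ⊆ ·) {B ∈ powersetCard b s | p B} A) = (#s - a).choose (b - a) := by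
    intro A hA
    rw [mem_filter, mem_powersetCard] at hA
    rw [bipartiteAbove, filter_filter, ← hA.1.2,
      ← card_filter_powersetCard_subset A s b hA.1.1 (hA.1.2.trans_le hle)]
    congr 1
    exact filter_congr fun B _ => and_iff_right_of_imp fun h => hp h hA.2
  have hsub : ∀ B ∈ {B ∈ powersetCard b s | p B},
      bipartiteBelow (· ⊆ ·) {A ∈ powersetCard a s | p A} B ⊆ powersetCard a B := by
    intro B _ A hA
    rw [mem_bipartiteBelow, mem_filter, mem_powersetCard] at hA
    exact mem_powersetCard.2 ⟨hA.2, hA.1.1.2⟩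
  have hdown : ∀ B ∈ {B ∈ powersetCard b s | p B},
      #(bipartiteBelow (· ⊆ ·) {A ∈ powersetCard a s | p A} B) ≤ b.choose a := by
    intro B hB
    refine (card_le_card (hsub B hB)).trans_eq ?_
    rw [card_powersetCard, (mem_powersetCard.1 (mem_filter.1 hB).1).2]
  have hB₀ : B₀ ∈ {B ∈ powersetCard b s | p B} := by grind
  have hdown_lt : #(bipartiteBelow (· ⊆ ·) {A ∈ powersetCard a s | p A} B₀) < b.choose a := by
    rw [← hB, ← card_powersetCard]
    refine card_lt_card ⟨hsub B₀ hB₀, fun h => hpA ?_⟩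
    exact (mem_filter.1 (mem_filter.1 (h (mem_powersetCard.2 ⟨hAB, hA⟩))).1).2
  have hchoose : b.choose a ≤ (#s - a).choose (b - a) := by
    rw [← Nat.choose_symm hle]
    exact Nat.choose_le_choose _ (by omega)
  have hcount : #{A ∈ powersetCard a s | p A} * (#s - a).choose (b - a) <
      #{B ∈ powersetCard b s | p B} * b.choose a := by
    rw [← sum_const_nat hup, ← sum_const_nat (fun _ _ => rfl),
      sum_card_bipartiteAbove_eq_sum_card_bipartiteBelow]
    exact sum_lt_sum hdown ⟨B₀, hB₀, hdown_lt⟩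
  exact lt_of_mul_lt_mul_right (hcount.trans_le (Nat.mul_le_mul_left _ hchoose)) (Nat.zero_le _)

/-! ### Duality and the gap -/

theorem StronglyIntersectInLargest.lexLE_iff_not_lexLE_sdiff {n : ℕ} {S T A : Finset ℕ}
    (hST : StronglyIntersectInLargest S T) (hT : T ⊆ Icc 2 n) (hA : A ⊆ Icc 2 n) :
    lexLE A (S ∩ Icc 2 n) ↔ ¬ lexLE (Icc 2 n \ A) T := by
  obtain ⟨j, hinter, hunion⟩ := hST
  have hj : j ∈ S ∧ j ∈ T := mem_inter.1 (hinter ▸ mem_singleton_self j)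
  have hjT {x : ℕ} (hxS : x ∈ S) (hxT : x ∈ T) : x = j :=
    mem_singleton.1 (hinter ▸ mem_inter.2 ⟨hxS, hxT⟩)
  have hmem {x : ℕ} : x ∈ S ∨ x ∈ T ↔ 1 ≤ x ∧ x ≤ j := by
    rw [← mem_union, hunion, mem_Icc]
  have hle {x : ℕ} (hx : x ∈ Icc 2 n) : 1 ≤ x := one_le_two.trans (mem_Icc.1 hx).1
  rw [not_lexLE, lexLT_iff]
  simp only [mem_sdiff, not_and, not_not]
  constructor
  · intro h
    by_cases hsub : S ∩ Icc 2 n ⊆ A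
    · refine ⟨j, hj.2, fun _ => hsub (mem_inter.2 ⟨hj.1, hT hj.2⟩), fun y hy hyT => ?_⟩
      grind
    · obtain ⟨x, hx, hxy⟩ := h.resolve_left hsub
      obtain ⟨y, hyS, hyA⟩ := not_subset.1 hsub
      have hxy' : x < y := hxy y (mem_sdiff.2 ⟨hyS, hyA⟩)
      have hyj : y ≤ j := (hmem.1 (Or.inl (mem_inter.1 hyS).1)).2
      have hxT : x ∈ T := by grind
      refine ⟨x, hxT, fun _ => (mem_sdiff.1 hx).1, fun z hz hzT => ?_⟩
      by_cases hzj : z ≤ j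
      · have hzS : z ∈ S := (hmem.2 ⟨hle hz.1, hzj⟩).resolve_right hzT
        exact hxy z (mem_sdiff.2 ⟨mem_inter.2 ⟨hzS, hz.1⟩, hz.2⟩)
      · omega
  · rintro ⟨x, hxT, hxA, hxy⟩
    have hxA : x ∈ A := hxA (hT hxT)
    rcases eq_or_ne x j with rfl | hxj
    · left
      grind
    · right
      refine ⟨x, by grind, fun y hy => ?_⟩
      grind

/-- The surplus, among the sets preceding `T`, of the `(n - k)`-sets over the `k`-sets.
By complementation in `[2, n]`, this is `(n - 1).choose (k - 1)` minus the sum of cardinalities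
in the theorem, for any `S` strongly intersecting `T` in the largest element. -/
def complementGap (n k : ℕ) (T : Finset ℕ) : ℤ :=
  #(lexFamily n T (n - k)) - #(lexFamily n T k)

theorem StronglyIntersectInLargest.card_lexFamily_add_card_lexFamily {n a b : ℕ} {S T : Finset ℕ}
    (hST : StronglyIntersectInLargest S T) (hT : T ⊆ Icc 2 n) (hab : a + b + 1 = n) :
    #(lexFamily n S a) + #(lexFamily n T b) = (n - 1).choose a := by
  have hcard : #(Icc 2 n) = a + b := by rw [Nat.card_Icc]; omega
  have hcompl : #(lexFamily n T b) =
      #{A ∈ powersetCard a (Icc 2 n) | ¬ lexLE A (S ∩ Icc 2 n)} := by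
    rw [lexFamily, inter_eq_left.2 hT]
    refine card_nbij' (Icc 2 n \ ·) (Icc 2 n \ ·) ?_ ?_ ?_ ?_
    · intro B hB
      rw [mem_coe, mem_filter, mem_powersetCard] at hB ⊢
      obtain ⟨⟨hBs, rfl⟩, hBT⟩ := hB
      refine ⟨⟨sdiff_subset, by rw [card_sdiff_of_subset hBs]; omega⟩, ?_⟩
      rwa [hST.lexLE_iff_not_lexLE_sdiff hT sdiff_subset, not_not, Finset.sdiff_sdiff_eq_self hBs]
    · intro A hA
      rw [mem_coe, mem_filter, mem_powersetCard] at hA ⊢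
      obtain ⟨⟨hAs, rfl⟩, hAS⟩ := hA
      refine ⟨⟨sdiff_subset, by rw [card_sdiff_of_subset hAs]; omega⟩, ?_⟩
      rwa [hST.lexLE_iff_not_lexLE_sdiff hT hAs, not_not] at hAS
    · exact fun B hB => Finset.sdiff_sdiff_eq_self (mem_powersetCard.1 (mem_filter.1 hB).1).1
    · exact fun A hA => Finset.sdiff_sdiff_eq_self (mem_powersetCard.1 (mem_filter.1 hA).1).1
  rw [hcompl, lexFamily, card_filter_add_card_filter_not, card_powersetCard, Nat.card_Icc]
  congr 1

theorem StronglyIntersectInLargest.card_add_card_eq_sub_complementGap {n k : ℕ} {S T : Finset ℕ}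
    (hST : StronglyIntersectInLargest S T) (hT : T ⊆ Icc 2 n) (hk : 1 ≤ k) (hkn : k ≤ n) :
    ((#(lexFamily n S (k - 1)) + #(lexFamily n T k) : ℕ) : ℤ) =
      (n - 1).choose (k - 1) - complementGap n k T := by
  have h := hST.card_lexFamily_add_card_lexFamily (a := k - 1) (b := n - k) hT (by omega)
  rw [complementGap, ← h]
  push_cast
  ring

theorem card_lexFamily_eq_add_card_filter {n a i : ℕ} {X T : Finset ℕ} (hX : ∀ x ∈ X, x < i)
    (hTX : T ∩ Iic i = X) (hins : insert i X ⊆ Icc 2 n) (hT : T ⊆ Icc 2 n) (ha : #X ≤ a) :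
    #(lexFamily n T a) = #(lexFamily n (insert i X) a) +
      #{B ∈ powersetCard (a - #X) (Icc 2 n \ Iic i) | lexLE (X ∪ B) T} := by
  obtain ⟨hT_le, hT_gt⟩ := (inter_Iic_eq_iff hX).1 hTX
  rw [← card_filter_powersetCard_inter_eq ((subset_insert i X).trans hins)
    (fun x hx => mem_Iic.2 (hX x hx).le) ha fun A => lexLE A T]
  simp only [lexFamily, inter_eq_left.2 hT, inter_eq_left.2 hins]
  rw [← card_filter_add_card_filter_not (fun A => lexLE A (insert i X)), filter_filter,
    filter_filter]
  congr 2 <;> refine filter_congr fun A _ => ?_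
  · exact and_iff_right_of_imp fun h => lexLE_trans h hT_gt.1
  · rw [inter_Iic_eq_iff hX, not_lexLE]
    exact ⟨fun h => ⟨⟨lexLE_trans h.1 hT_le, h.2⟩, h.1⟩, fun h => ⟨h.2, h.1.2⟩⟩

theorem card_Icc_two_sdiff_Iic {n i : ℕ} (hi : 1 ≤ i) : #(Icc 2 n \ Iic i) = n - i := by
  have : Icc 2 n \ Iic i = Ioc i n := by grind
  rw [this, Nat.card_Ioc]

theorem complementGap_insert_two_mul_card {n k : ℕ} {T : Finset ℕ} (hT : T ⊆ Icc 2 n)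
    (hlt : ∀ x ∈ T, x < 2 * #T) (hne : T.Nonempty) (hk : #T ≤ k) (hn : 2 * k ≤ n) :
    complementGap n k (insert (2 * #T) T) = complementGap n k T := by
  have hpos : 0 < #T := hne.card_pos
  have hins : insert (2 * #T) T ⊆ Icc 2 n := by
    refine insert_subset (mem_Icc.2 ?_) hT
    omega
  have hcount {a : ℕ} (ha : #T ≤ a) : #(lexFamily n T a) =
      #(lexFamily n (insert (2 * #T) T) a) + (n - 2 * #T).choose (a - #T) := by
    rw [card_lexFamily_eq_add_card_filter hlt
        (inter_eq_left.2 fun x hx => mem_Iic.2 (hlt x hx).le) hins hT ha,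
      filter_true_of_mem (p := fun B => lexLE (T ∪ B) T) fun B _ => Or.inl subset_union_left,
      card_powersetCard,
      card_Icc_two_sdiff_Iic (by omega)]
  have hsymm : (n - 2 * #T).choose (k - #T) = (n - 2 * #T).choose (n - k - #T) :=
    Nat.choose_symm_of_eq_add (by omega)
  rw [complementGap, complementGap, hcount hk, hcount (by omega : #T ≤ n - k), hsymm]
  push_cast
  ring

theorem exists_not_lexLE_union_and_lexLE_union {n i j a b : ℕ} {T : Finset ℕ} (hT : T ⊆ Icc 2 n)
    (hj : IsGreatest (T : Set ℕ) j) (hij : i < j) (ha : #(T \ Iic i) ≤ a + 1)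
    (han : a + j < #(T \ Iic i) + n) (hab : a < b) (hb : b ≤ #(Icc 2 n \ Iic i)) :
    ∃ A B : Finset ℕ, A ⊆ B ∧ B ⊆ Icc 2 n \ Iic i ∧ #A = a ∧ #B = b ∧
      ¬ lexLE (T ∩ Iic i ∪ A) T ∧ lexLE (T ∩ Iic i ∪ B) T := by
  have hjT : j ∈ T \ Iic i := mem_sdiff.2 ⟨hj.1, fun h => hij.not_ge (mem_Iic.1 h)⟩
  have hjn : 2 ≤ j ∧ j ≤ n := mem_Icc.1 (hT hj.1)
  have hle {x : ℕ} (hx : x ∈ T) : x ≤ j := hj.2 hx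
  have hcard : #((T \ Iic i).erase j) = #(T \ Iic i) - 1 := card_erase_of_mem hjT
  have hcard_union : #((T \ Iic i).erase j ∪ Ioc j n) = #(T \ Iic i) - 1 + (n - j) := by
    rw [card_union_of_disjoint, hcard, Nat.card_Ioc]
    exact disjoint_left.2 fun x hx hx' => by grind
  obtain ⟨A, hTA, hAT, hA⟩ := exists_subsuperset_card_eq
    (subset_union_left : (T \ Iic i).erase j ⊆ _ ∪ Ioc j n) (n := a) (by omega) (by omega)
  have hjA : j ∉ A := fun h => by grind
  have hAs : insert j A ⊆ Icc 2 n \ Iic i := by grind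
  obtain ⟨B, hAB, hBs, hB⟩ := exists_subsuperset_card_eq hAs (n := b)
    (by rw [card_insert_of_notMem hjA]; omega) hb
  refine ⟨A, B, (subset_insert j A).trans hAB, hBs, hA, hB, ?_, Or.inl ?_⟩
  · rw [not_lexLE, lexLT_iff]
    refine ⟨j, hj.1, by grind, fun y hy hyT => ?_⟩
    grind
  · intro x hx
    grind

theorem isGreatest_of_inter_eq_of_union_eq {S T : Finset ℕ} {j : ℕ} (hinter : S ∩ T = {j})
    (hunion : S ∪ T = Icc 1 j) : IsGreatest (T : Set ℕ) j := by
  refine ⟨(mem_inter.1 (hinter ▸ mem_singleton_self j)).2, fun x hx => ?_⟩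
  exact (mem_Icc.1 (hunion ▸ mem_union_right S hx)).2

theorem card_add_card_of_inter_eq_of_union_eq {S T : Finset ℕ} {j : ℕ} (hinter : S ∩ T = {j})
    (hunion : S ∪ T = Icc 1 j) : #S + #T = j + 1 := by
  rw [← card_union_add_card_inter, hinter, hunion, Nat.card_Icc, card_singleton]
  rfl

theorem StronglyIntersectInLargest.complementGap_insert_lt {n k i : ℕ} {S T : Finset ℕ}
    (hST : StronglyIntersectInLargest S T) (hT : T ⊆ Icc 2 n) (hSk : #S ≤ k) (hTk : #T ≤ k)
    (hn : 2 * k < n) (hpos : 0 < i) (hi : 2 * #(T ∩ Iic i) = i) (hlt : ∀ y ∈ T ∩ Iic i, y < i)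
    (hex : ∃ x ∈ T, i < x) :
    complementGap n k (insert i (T ∩ Iic i)) < complementGap n k T := by
  obtain ⟨j, hinter, hunion⟩ := hST
  obtain ⟨x, hx, hix⟩ := hex
  have hj := isGreatest_of_inter_eq_of_union_eq hinter hunion
  have hcard := card_add_card_of_inter_eq_of_union_eq hinter hunion
  have hxj : x ≤ j := hj.2 hx
  have hjn : j ≤ n := (mem_Icc.1 (hT hj.1)).2
  have hsplit : #(T ∩ Iic i) + #(T \ Iic i) = #T := card_inter_add_card_sdiff T _
  have hlast : 0 < #(T \ Iic i) := card_pos.2 ⟨x, by simpa [hx] using hix⟩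
  have hins : insert i (T ∩ Iic i) ⊆ Icc 2 n :=
    insert_subset (mem_Icc.2 ⟨by omega, by omega⟩) (inter_subset_left.trans hT)
  have hground : #(Icc 2 n \ Iic i) = n - i := card_Icc_two_sdiff_Iic hpos
  obtain ⟨A, B, hAB, hBs, hA, hB, hAT, hBT⟩ := exists_not_lexLE_union_and_lexLE_union hT hj
    (a := k - #(T ∩ Iic i)) (b := n - k - #(T ∩ Iic i)) (hix.trans_le hxj)
    (by omega) (by omega) (by omega) (by omega)
  have hmono : Monotone fun A => lexLE (T ∩ Iic i ∪ A) T := fun A B hAB h =>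
    lexLE_trans (Or.inl (union_subset_union_right hAB)) h
  have hstrict := card_filter_powersetCard_lt_of_monotone (by omega) hmono hAB hBs hA hB hAT hBT
  rw [complementGap, complementGap,
    card_lexFamily_eq_add_card_filter hlt rfl hins hT (by omega : #(T ∩ Iic i) ≤ k),
    card_lexFamily_eq_add_card_filter hlt rfl hins hT (by omega : #(T ∩ Iic i) ≤ n - k)]
  push_cast
  omega

/-! ### Ballot sets and resistant sets -/

/-- A set `T ⊆ [2, ∞)` containing `2, 3, 4` is a *ballot set* if each element `x > 4` of `T`
satisfies `x ≤ 2 * #(T ∩ [1, x - 1])`. Equivalently, the elements outnumber the non-elements in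
`[1, i]` for `4 ≤ i < max T`. The `T_l`-neutral sets are ballot sets. -/
structure IsBallot (T : Finset ℕ) : Prop where
  two_le : ∀ x ∈ T, 2 ≤ x
  base : Icc 2 4 ⊆ T
  le_two_mul : ∀ x ∈ T, 4 < x → x ≤ 2 * #(T ∩ Iio x)

theorem three_le_card_of_Icc_subset {T : Finset ℕ} (h : Icc 2 4 ⊆ T) : 3 ≤ #T :=
  (by rfl : 3 = #(Icc 2 4)).trans_le (card_le_card h)

theorem IsBallot.lt_two_mul_card {T : Finset ℕ} (h : IsBallot T) {x : ℕ} (hx : x ∈ T) :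
    x < 2 * #T := by
  rcases le_or_gt x 4 with hx4 | hx4
  · have := three_le_card_of_Icc_subset h.base
    omega
  · have hlt : #(T ∩ Iio x) < #T := by
      refine card_lt_card ⟨inter_subset_left, fun hsub => ?_⟩
      exact lt_irrefl x (mem_Iio.1 (mem_inter.1 (hsub hx)).2)
    have := h.le_two_mul x hx hx4
    omega

theorem IsBallot.lt_two_mul_card_inter_Iic {T : Finset ℕ} (h : IsBallot T) {x i : ℕ} (hx : x ∈ T)
    (hi : 4 ≤ i) (hix : i < x) : i < 2 * #(T ∩ Iic i) := by
  have hne : (T \ Iic i).Nonempty := ⟨x, by simpa [hx] using hix⟩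
  set y := (T \ Iic i).min' hne with hy
  have hymem : y ∈ T ∧ i < y := by
    have := min'_mem _ hne
    rwa [← hy, mem_sdiff, mem_Iic, not_le] at this
  have hsub : T ∩ Iio y ⊆ T ∩ Iic i := by
    intro z hz
    rw [mem_inter, mem_Iio] at hz
    by_contra hzi
    have : y ≤ z := min'_le _ z (by grind)
    omega
  have := h.le_two_mul y hymem.1 (by omega)
  have := card_le_card hsub
  omega

theorem IsBallot.insert_two_mul_card {T : Finset ℕ} (h : IsBallot T) :
    IsBallot (insert (2 * #T) T) := by
  have h3 := three_le_card_of_Icc_subset h.base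
  refine ⟨?_, h.base.trans (subset_insert _ _), ?_⟩
  · intro x hx
    rcases mem_insert.1 hx with rfl | hx
    · omega
    · exact h.two_le x hx
  · intro x hx hx4
    rcases mem_insert.1 hx with rfl | hx
    · gcongr 2 * ?_
      refine card_le_card fun y hy => ?_
      exact mem_inter.2 ⟨mem_insert_of_mem hy, mem_Iio.2 (h.lt_two_mul_card hy)⟩
    · refine (h.le_two_mul x hx hx4).trans ?_
      gcongr
      exact subset_insert _ _

theorem IsBallot.of_isNeutralSet {R T : Finset ℕ} (hR : IsBallot R) (h : IsNeutralSet R T) :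
    IsBallot T := by
  induction h with
  | base => exact hR
  | step T' _ hT' => exact union_singleton _ T' ▸ hT'.insert_two_mul_card

theorem IsBallot.notMem_two_mul_card {T : Finset ℕ} (h : IsBallot T) : 2 * #T ∉ T :=
  fun hmem => (h.lt_two_mul_card hmem).false

theorem IsBallot.subset_Icc {T : Finset ℕ} (h : IsBallot T) {n : ℕ} (hn : 2 * #T ≤ n) :
    T ⊆ Icc 2 n := fun x hx =>
  mem_Icc.2 ⟨h.two_le x hx, (h.lt_two_mul_card hx).le.trans hn⟩

theorem IsBallot.complementGap_eq_of_isNeutralSet {R T : Finset ℕ} {n k : ℕ} (hR : IsBallot R)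
    (hn : 2 * k ≤ n) (h : IsNeutralSet R T) (hk : #T ≤ k + 1) :
    complementGap n k T = complementGap n k R := by
  induction h with
  | base => rfl
  | step T' hRT' ih =>
    have hT' := hR.of_isNeutralSet hRT'
    rw [union_singleton] at hk ⊢
    rw [card_insert_of_notMem hT'.notMem_two_mul_card] at hk
    rw [← ih (by omega)]
    exact complementGap_insert_two_mul_card (hT'.subset_Icc (by omega))
      (fun x hx => hT'.lt_two_mul_card hx) ⟨2, hT'.base (by decide)⟩ (by omega) hn

/-- The sets `T` occurring in resistant pairs: the ballot sets which do not arise from a smaller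
ballot set by a neutral step, that is, `[2, 4]` and those with `max T < 2 * (#T - 1)`. -/
structure IsResistantSet (T : Finset ℕ) : Prop extends IsBallot T where
  eq_or_add_two_lt : T = Icc 2 4 ∨ ∀ x ∈ T, x + 2 < 2 * #T

theorem isBallot_inter_Iio {T : Finset ℕ} (htwo : ∀ y ∈ T, 2 ≤ y) (hbase : Icc 2 4 ⊆ T) {x : ℕ}
    (hx : 4 < x) (hle : ∀ y ∈ T, 4 < y → y < x → y ≤ 2 * #(T ∩ Iio y)) :
    IsBallot (T ∩ Iio x) where
  two_le y hy := htwo y (mem_inter.1 hy).1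
  base y hy := mem_inter.2 ⟨hbase hy, mem_Iio.2 ((mem_Icc.1 hy).2.trans_lt hx)⟩
  le_two_mul y hy hy4 := by
    rw [mem_inter, mem_Iio] at hy
    rw [inter_assoc, inter_eq_right.2 (Iio_subset_Iio hy.2.le)]
    exact hle y hy.1 hy4 hy.2

theorem exists_isBallot_inter_Iic {T : Finset ℕ} (htwo : ∀ x ∈ T, 2 ≤ x) (hbase : Icc 2 4 ⊆ T)
    (h : ¬ IsBallot T) :
    ∃ i, IsBallot (T ∩ Iic i) ∧ 2 * #(T ∩ Iic i) = i ∧ ∃ x ∈ T, i < x := by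
  classical
  have hviol : ∃ x, x ∈ T ∧ 4 < x ∧ 2 * #(T ∩ Iio x) < x := by
    by_contra! hle
    exact h ⟨htwo, hbase, hle⟩
  set x := Nat.find hviol
  obtain ⟨hx, hx4, hxlt⟩ : x ∈ T ∧ 4 < x ∧ 2 * #(T ∩ Iio x) < x := Nat.find_spec hviol
  have hballot : IsBallot (T ∩ Iio x) := by
    refine isBallot_inter_Iio htwo hbase hx4 fun y hy hy4 hyx => ?_
    by_contra! hy_lt
    exact Nat.find_min hviol hyx ⟨hy, hy4, hy_lt⟩
  have htrace : T ∩ Iic (2 * #(T ∩ Iio x)) = T ∩ Iio x := by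
    ext y
    have hy_lt : y ∈ T ∩ Iio x → y < 2 * #(T ∩ Iio x) := hballot.lt_two_mul_card
    simp only [mem_inter, mem_Iic, mem_Iio] at hy_lt ⊢
    exact ⟨fun hy => ⟨hy.1, hy.2.trans_lt hxlt⟩, fun hy => ⟨hy.1, (hy_lt hy).le⟩⟩
  exact ⟨2 * #(T ∩ Iio x), by rwa [htrace], by rw [htrace], x, hx, hxlt⟩

theorem IsBallot.eq_insert_of_two_mul_card_le {T : Finset ℕ} (h : IsBallot T) {x : ℕ} (hx : x ∈ T)
    (hx4 : 4 < x) (hle : 2 * #T ≤ x + 2) :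
    T = insert (2 * #(T ∩ Iio x)) (T ∩ Iio x) := by
  have hsub : T ∩ Iio x ⊆ T.erase x := fun y hy =>
    mem_erase.2 ⟨(mem_Iio.1 (mem_inter.1 hy).2).ne, (mem_inter.1 hy).1⟩
  have hcard : #(T.erase x) + 1 = #T := card_erase_add_one hx
  have hle' := h.le_two_mul x hx hx4
  have heq : T ∩ Iio x = T.erase x := eq_of_subset_of_card_le hsub (by omega)
  have hxeq : 2 * #(T.erase x) = x := by
    rw [heq] at hle'
    omega
  rw [heq, hxeq, insert_erase hx]

theorem IsBallot.exists_isResistantSet {T : Finset ℕ} (h : IsBallot T) :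
    ∃ R, IsResistantSet R ∧ R ⊆ T ∧ IsNeutralSet R T := by
  induction T using Finset.strongInduction with
  | H T ih =>
  by_cases hres : T = Icc 2 4 ∨ ∀ x ∈ T, x + 2 < 2 * #T
  · exact ⟨T, ⟨h, hres⟩, subset_rfl, .base⟩
  push Not at hres
  obtain ⟨hne, x, hx, hle⟩ := hres
  have hcard : 3 < #T := card_lt_card (h.base.ssubset_of_ne hne.symm)
  have hx4 : 4 < x := by omega
  have hT : T = insert (2 * #(T ∩ Iio x)) (T ∩ Iio x) :=
    h.eq_insert_of_two_mul_card_le hx hx4 hle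
  have hssub : T ∩ Iio x ⊂ T :=
    ⟨inter_subset_left, fun hsub => lt_irrefl x (mem_Iio.1 (mem_inter.1 (hsub hx)).2)⟩
  obtain ⟨R, hR, hRsub, hneutral⟩ := ih _ hssub
    (isBallot_inter_Iio h.two_le h.base hx4 fun y hy hy4 _ => h.le_two_mul y hy hy4)
  refine ⟨R, hR, hRsub.trans hssub.subset, ?_⟩
  rw [hT, ← union_singleton]
  exact .step _ hneutral

theorem IsResistantSet.lexLE_of_isNeutralSet {R R' T : Finset ℕ} (hR' : IsResistantSet R')
    (hR : IsBallot R) (hT : IsNeutralSet R T) (hTR' : lexLE T R') : lexLE R R' := by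
  induction hT with
  | base => exact hTR'
  | step T hRT ih =>
    have hT := hR.of_isNeutralSet hRT
    have hcard := three_le_card_of_Icc_subset hT.base
    rw [union_singleton] at hTR'
    refine ih ?_
    by_contra hlt
    rw [not_lexLE] at hlt
    by_cases hins : insert (2 * #T) T = R'
    · have hcard' : #R' = #T + 1 := hins ▸ card_insert_of_notMem hT.notMem_two_mul_card
      rcases hR'.eq_or_add_two_lt with rfl | hlt'
      · have : #(Icc 2 4) = 3 := rfl
        omega
      · have := hlt' (2 * #T) (hins ▸ mem_insert_self _ _)
        omega
    · have htrace : R' ∩ Iic (2 * #T) = T :=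
        (inter_Iic_eq_iff fun x hx => hT.lt_two_mul_card hx).2 ⟨hlt.1, hTR', hins⟩
      obtain ⟨x, hx, hx_lt⟩ : ∃ x ∈ R', 2 * #T < x := by
        by_contra! hle
        exact hlt.2 (htrace ▸ (inter_eq_left.2 fun x hx => mem_Iic.2 (hle x hx)).symm)
      have := hR'.lt_two_mul_card_inter_Iic hx (by omega) hx_lt
      rw [htrace] at this
      exact this.false

/-! ### Resistant pairs -/

theorem card_Icc_one_inter_lt_card_sdiff_iff {S : Finset ℕ} {i : ℕ} :
    #(Icc 1 i ∩ S) < #(Icc 1 i \ S) ↔ i < 2 * #(Icc 1 i \ S) := by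
  have h : #(Icc 1 i ∩ S) + #(Icc 1 i \ S) = i := by
    rw [card_inter_add_card_sdiff, Nat.card_Icc, Nat.add_sub_cancel]
  omega

theorem Icc_sdiff_eq_erase_inter_Iic {S T : Finset ℕ} {i j : ℕ} (hinter : S ∩ T = {j})
    (hunion : S ∪ T = Icc 1 j) (hij : i ≤ j) : Icc 1 i \ S = T.erase j ∩ Iic i := by
  ext x
  have hmem_inter : x ∈ S ∧ x ∈ T ↔ x = j := by rw [← mem_inter, hinter, mem_singleton]
  have hmem_union : x ∈ S ∨ x ∈ T ↔ 1 ≤ x ∧ x ≤ j := by rw [← mem_union, hunion, mem_Icc]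
  simp only [mem_sdiff, mem_Icc, mem_inter, mem_erase, mem_Iic]
  grind

theorem Icc_two_four_subset_of_forall_card_lt {S T : Finset ℕ} {j : ℕ} (hinter : S ∩ T = {j})
    (hunion : S ∪ T = Icc 1 j) (htwo : ∀ x ∈ T, 2 ≤ x)
    (hlt : #(Icc 1 4 ∩ S) < #(Icc 1 4 \ S)) : Icc 2 4 ⊆ T ∧ 4 < j := by
  have hmem {x : ℕ} : x ∈ S ∨ x ∈ T ↔ 1 ≤ x ∧ x ≤ j := by rw [← mem_union, hunion, mem_Icc]
  have hj : j ∈ S ∧ j ∈ T := mem_inter.1 (hinter ▸ mem_singleton_self j)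
  have hj2 : 2 ≤ j := htwo j hj.2
  have h1S : 1 ∈ S := (hmem.2 ⟨le_rfl, by omega⟩).resolve_right fun h => by simpa using htwo 1 h
  have hsub : Icc 1 4 \ S ⊆ Icc 2 4 := by
    intro x hx
    have : x ≠ 1 := fun h => (mem_sdiff.1 hx).2 (h ▸ h1S)
    rw [mem_sdiff, mem_Icc] at hx
    exact mem_Icc.2 ⟨by omega, hx.1.2⟩
  have heq : Icc 1 4 \ S = Icc 2 4 := by
    refine eq_of_subset_of_card_le hsub ?_
    rw [card_Icc_one_inter_lt_card_sdiff_iff] at hlt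
    change 3 ≤ _
    omega
  have hj4 : 4 < j := by
    by_contra! hj4
    exact (mem_sdiff.1 (heq ▸ mem_Icc.2 ⟨hj2, hj4⟩)).2 hj.1
  refine ⟨fun x hx => ?_, hj4⟩
  have hxS : x ∉ S := (mem_sdiff.1 (heq ▸ hx)).2
  rw [mem_Icc] at hx
  exact (hmem.2 ⟨by omega, by omega⟩).resolve_left hxS

theorem isResistantSet_Icc : IsResistantSet (Icc 2 4) where
  two_le _ hx := (mem_Icc.1 hx).1
  base := subset_rfl
  le_two_mul _ hx hx4 := absurd (mem_Icc.1 hx).2 hx4.not_ge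
  eq_or_add_two_lt := Or.inl rfl

theorem IsResistantPair.stronglyIntersectInLargest {n k : ℕ} {S T : Finset ℕ}
    (h : IsResistantPair n k S T) : StronglyIntersectInLargest S T := by
  obtain ⟨-, -, ⟨rfl, rfl⟩ | ⟨j, -, ⟨hinter, hunion, -⟩, -⟩⟩ := h
  · exact ⟨4, by decide, by decide⟩
  · exact ⟨j, hinter, hunion⟩

theorem IsResistantPair.isResistantSet {n k : ℕ} {S T : Finset ℕ}
    (h : IsResistantPair n k S T) : IsResistantSet T := by
  obtain ⟨-, hT, ⟨rfl, -⟩ | ⟨j, hj, ⟨hinter, hunion, -⟩, hlt⟩⟩ := h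
  · exact isResistantSet_Icc
  have htwo : ∀ x ∈ T, 2 ≤ x := fun x hx => (mem_Icc.1 (hT hx)).1
  obtain ⟨hbase, hj4⟩ := Icc_two_four_subset_of_forall_card_lt hinter hunion htwo (hlt 4 le_rfl)
  have htrace {i : ℕ} (hi : 4 ≤ i) (hij : i ≤ j) : i < 2 * #(T.erase j ∩ Iic i) := by
    rw [← Icc_sdiff_eq_erase_inter_Iic hinter hunion hij,
      ← card_Icc_one_inter_lt_card_sdiff_iff]
    exact hlt i hi
  refine ⟨⟨htwo, hbase, fun x hx hx4 => ?_⟩, Or.inr fun x hx => ?_⟩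
  · have hxj : x ≤ j := hj.2 hx
    have hlt := htrace (i := x - 1) (by omega) (by omega)
    have hsub : T.erase j ∩ Iic (x - 1) ⊆ T ∩ Iio x := by grind
    have := card_le_card hsub
    omega
  · have hxj : x ≤ j := hj.2 hx
    have hlt := htrace hj4.le le_rfl
    have := card_le_card (inter_subset_left : T.erase j ∩ Iic j ⊆ T.erase j)
    have := card_erase_add_one hj.1
    omega

theorem IsBallot.card_Icc_inter_lt_card_sdiff {S T : Finset ℕ} {i j : ℕ} (h : IsBallot T)
    (hinter : S ∩ T = {j}) (hunion : S ∪ T = Icc 1 j) (hlt : j + 2 < 2 * #T) (hi : 4 ≤ i) :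
    #(Icc 1 i ∩ S) < #(Icc 1 i \ S) := by
  have hj := isGreatest_of_inter_eq_of_union_eq hinter hunion
  rcases lt_or_ge i j with hij | hji
  · have htrace : T.erase j ∩ Iic i = T ∩ Iic i := by grind
    rw [card_Icc_one_inter_lt_card_sdiff_iff,
      Icc_sdiff_eq_erase_inter_Iic hinter hunion hij.le, htrace]
    exact h.lt_two_mul_card_inter_Iic hj.1 hi hij
  · have hS : S ⊆ Icc 1 j := hunion ▸ subset_union_left
    have hlast : #(Icc 1 j ∩ S) < #(Icc 1 j \ S) := by
      rw [card_Icc_one_inter_lt_card_sdiff_iff,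
        Icc_sdiff_eq_erase_inter_Iic hinter hunion le_rfl,
        inter_eq_left.2 fun x hx => mem_Iic.2 (hj.2 (mem_of_mem_erase hx)), card_erase_of_mem hj.1]
      omega
    calc #(Icc 1 i ∩ S) ≤ #S := card_le_card inter_subset_right
      _ = #(Icc 1 j ∩ S) := by rw [inter_eq_right.2 hS]
      _ < #(Icc 1 j \ S) := hlast
      _ ≤ #(Icc 1 i \ S) := card_le_card (sdiff_subset_sdiff (Icc_subset_Icc_right hji) subset_rfl)

theorem IsResistantSet.exists_isResistantPair {n k : ℕ} {T : Finset ℕ} (h : IsResistantSet T)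
    (hk : #T ≤ k) (hn : 2 * k ≤ n) : ∃ S, IsResistantPair n k S T := by
  have hT : T ⊆ Icc 2 n := h.subset_Icc (by omega)
  rcases h.eq_or_add_two_lt with rfl | hlt
  · refine ⟨{1, 4}, ?_, hT, Or.inl ⟨rfl, rfl⟩⟩
    have h4 : 4 ≤ n := (mem_Icc.1 (hT (by decide : 4 ∈ Icc 2 4))).2
    intro x hx
    grind
  have hne : T.Nonempty := ⟨2, h.base (by decide)⟩
  obtain ⟨j, hj⟩ : ∃ j, IsGreatest (T : Set ℕ) j := ⟨_, isGreatest_max' T hne⟩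
  have hle {x : ℕ} (hx : x ∈ T) : 2 ≤ x ∧ x ≤ j := ⟨h.two_le x hx, hj.2 hx⟩
  have hjT : j ∈ T := hj.1
  have hinter : insert j (Icc 1 j \ T) ∩ T = {j} := by grind
  have hunion : insert j (Icc 1 j \ T) ∪ T = Icc 1 j := by grind
  have hcard := card_add_card_of_inter_eq_of_union_eq hinter hunion
  have hj_lt := hlt j hjT
  have hjn : j ≤ n := (mem_Icc.1 (hT hjT)).2
  refine ⟨insert j (Icc 1 j \ T), ?_, hT, Or.inr ⟨j, hj, ⟨hinter, hunion, by omega, hk⟩, ?_⟩⟩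
  · exact subset_union_left.trans (hunion.trans_subset (Icc_subset_Icc_right hjn))
  · exact fun i hi => h.toIsBallot.card_Icc_inter_lt_card_sdiff hinter hunion hj_lt hi

theorem IsResistantEnumeration.isResistantPair {n k m : ℕ} {S T : ℕ → Finset ℕ}
    (h : IsResistantEnumeration n k m S T) {l : ℕ} (hl : 1 ≤ l) (hlm : l ≤ m) :
    IsResistantPair n k (S l) (T l) :=
  (h.mem_iff _ _).2 ⟨l, mem_Icc.2 ⟨hl, hlm⟩, rfl, rfl⟩

theorem IsResistantEnumeration.eq_of_lexLT_of_lexLE {n k m : ℕ} {S T : ℕ → Finset ℕ}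
    (h : IsResistantEnumeration n k m S T) {R : Finset ℕ} (hR : IsResistantSet R) (hk : #R ≤ k)
    (hn : 2 * k ≤ n) {l : ℕ} (hlm : l ≤ m) (hlow : lexLT (T (l - 1)) R) (hup : lexLE R (T l)) :
    R = T l := by
  obtain ⟨P, hP⟩ := hR.exists_isResistantPair hk hn
  obtain ⟨i, hi, -, rfl⟩ := (h.mem_iff P R).1 hP
  have him : i ≤ m := (mem_Icc.1 hi).2
  rcases lt_trichotomy i l with hil | rfl | hil
  · exfalso
    rcases (Nat.le_sub_one_of_lt hil).eq_or_lt with heq | hlt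
    · exact hlow.2 (heq ▸ rfl)
    · have := h.strictMono i (l - 1) hlt (by omega)
      exact hlow.2 (lexLE_antisymm hlow.1 this.1)
  · rfl
  · have := h.strictMono l i hil him
    exact lexLE_antisymm hup this.1

theorem IsResistantEnumeration.isNeutralSet {n k m : ℕ} {S T : ℕ → Finset ℕ}
    (h : IsResistantEnumeration n k m S T) {U : Finset ℕ} (hU : IsBallot U) (hk : #U ≤ k)
    (hn : 2 * k ≤ n) {l : ℕ} (hl : 1 ≤ l) (hlm : l ≤ m) (hlow : lexLT (T (l - 1)) U)
    (hup : lexLE (insert (2 * #U) U) (T l)) : IsNeutralSet (T l) U := by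
  obtain ⟨R, hR, hRU, hneutral⟩ := hU.exists_isResistantSet
  have hR_le : lexLE R (T l) := by
    refine (h.isResistantPair hl hlm).isResistantSet.lexLE_of_isNeutralSet hR.toIsBallot
      (.step U hneutral) ?_
    rwa [union_singleton]
  have hlowR : lexLT (T (l - 1)) R := lexLT_of_lexLT_of_lexLE hlow (Or.inl hRU)
  rwa [← h.eq_of_lexLT_of_lexLE hR ((card_le_card hRU).trans hk) hn hlm hlowR hR_le]

theorem StronglyIntersectInLargest.card_add_card_eq_iff_complementGap_eq {n k : ℕ}
    {S T S' T' : Finset ℕ} (hST : StronglyIntersectInLargest S T) (hT : T ⊆ Icc 2 n)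
    (hST' : StronglyIntersectInLargest S' T') (hT' : T' ⊆ Icc 2 n) (hk : 1 ≤ k) (hkn : k ≤ n) :
    #(lexFamily n S (k - 1)) + #(lexFamily n T k) =
        #(lexFamily n S' (k - 1)) + #(lexFamily n T' k) ↔
      complementGap n k T = complementGap n k T' := by
  rw [← Nat.cast_inj (R := ℤ), hST.card_add_card_eq_sub_complementGap hT hk hkn,
    hST'.card_add_card_eq_sub_complementGap hT' hk hkn, sub_right_inj]

theorem IsResistantEnumeration.isBallot_of_complementGap_eq {n k m : ℕ} {Sr Tr : ℕ → Finset ℕ}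
    (h : IsResistantEnumeration n k m Sr Tr) (hn : 2 * k < n) {S T : Finset ℕ}
    (hST : StronglyIntersectInLargest S T) (hT : T ⊆ Icc 2 n) (hSk : #S ≤ k) (hTk : #T ≤ k)
    {l : ℕ} (hl : 1 ≤ l) (hlm : l ≤ m) (hlow : lexLT (Tr (l - 1)) T) (hup : lexLE T (Tr l))
    (hgap : complementGap n k T = complementGap n k (Tr l)) : IsBallot T := by
  have hTr : IsResistantSet (Tr l) := (h.isResistantPair hl hlm).isResistantSet
  have htwo : ∀ x ∈ T, 2 ≤ x := fun x hx => (mem_Icc.1 (hT hx)).1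
  by_contra hballot
  obtain ⟨i, hU, hi, hex⟩ :=
    exists_isBallot_inter_Iic htwo (Icc_subset_of_lexLE htwo hTr.base hup) hballot
  have hlt : ∀ y ∈ T ∩ Iic i, y < i := fun y hy => hi ▸ hU.lt_two_mul_card hy
  have h3 := three_le_card_of_Icc_subset hU.base
  have hUk : #(T ∩ Iic i) ≤ k := (card_le_card inter_subset_left).trans hTk
  obtain ⟨hT_le, hT_gt⟩ := (inter_Iic_eq_iff hlt).1 rfl
  have hneutral : IsNeutralSet (Tr l) (insert i (T ∩ Iic i)) := by
    have hstep := IsNeutralSet.step _ (h.isNeutralSet hU hUk hn.le hl hlm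
      (lexLT_of_lexLT_of_lexLE hlow hT_le) (by rw [hi]; exact lexLE_trans hT_gt.1 hup))
    rwa [hi, union_singleton] at hstep
  have hgap_insert : complementGap n k (insert i (T ∩ Iic i)) = complementGap n k (Tr l) :=
    hTr.complementGap_eq_of_isNeutralSet hn.le hneutral
      ((card_insert_le _ _).trans (Nat.succ_le_succ hUk))
  have hstrict : complementGap n k (insert i (T ∩ Iic i)) < complementGap n k T :=
    hST.complementGap_insert_lt hT hSk hTk hn (by omega) hi hlt hex
  omega

theorem IsResistantEnumeration.complementGap_eq_iff_isNeutralSet {n k m : ℕ}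
    {Sr Tr : ℕ → Finset ℕ} (h : IsResistantEnumeration n k m Sr Tr) (hn : 2 * k < n)
    {S T : Finset ℕ} (hST : StronglyIntersectInLargest S T) (hT : T ⊆ Icc 2 n) (hSk : #S ≤ k)
    (hTk : #T ≤ k) {l : ℕ} (hl : 1 ≤ l) (hlm : l ≤ m) (hlow : lexLT (Tr (l - 1)) T)
    (hup : lexLE T (Tr l)) :
    complementGap n k T = complementGap n k (Tr l) ↔ IsNeutralSet (Tr l) T := by
  constructor
  · intro hgap
    have hballot := h.isBallot_of_complementGap_eq hn hST hT hSk hTk hl hlm hlow hup hgap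
    exact h.isNeutralSet hballot hTk hn.le hl hlm hlow
      (lexLE_trans (Or.inl (subset_insert _ _)) hup)
  · intro hneutral
    exact (h.isResistantPair hl hlm).isResistantSet.complementGap_eq_of_isNeutralSet hn.le
      hneutral (Nat.le_succ_of_le hTk)

end

theorem mainTheorem7 (n k : ℕ) (hk : 6 ≤ 2 * k) (hn : 2 * k < n)
    (m : ℕ) (Sr Tr : ℕ → Finset ℕ) (hr : IsResistantEnumeration n k m Sr Tr)
    (S T : Finset ℕ) (hS : S ⊆ Finset.Icc 1 n) (hT : T ⊆ Finset.Icc 2 n)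
    (hSk : S.card ≤ k) (hTk : T.card ≤ k)
    (hST : StronglyIntersectInLargest S T)
    (A B : Finset (Finset ℕ))
    (hA : A = lexFamily n S (k - 1)) (hB : B = lexFamily n T k)
    (l : ℕ) (hl : 1 ≤ l) (hlm : l ≤ m)
    (hlow : lexLT (Tr (l - 1)) T) (hup : lexLE T (Tr l)) :
    A.card + B.card = (lexFamily n (Sr l) (k - 1)).card + (lexFamily n (Tr l) k).card ↔
      IsNeutralPair (Tr l) S T := by
  have hpair : IsResistantPair n k (Sr l) (Tr l) := hr.isResistantPair hl hlm
  rw [hA, hB, hST.card_add_card_eq_iff_complementGap_eq hT hpair.stronglyIntersectInLargest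
      hpair.2.1 (by omega) (by omega),
    hr.complementGap_eq_iff_isNeutralSet hn hST hT hSk hTk hl hlm hlow hup, IsNeutralPair,
    and_iff_right hST]
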